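/- Let $n\ge 0$, $0<T<\infty$, let $N\subseteq\mathbb R^n$ be open (the control set; e.g. $N=\mathbb R^n$), let $f:\mathbb R^n\to\mathbb R^n$ and $\phi:\mathbb R^n\times\mathbb R^n\to\mathbb R$, $(q,v)\mapsto\phi(q,v)$, be continuously differentiable, and let $q^0,v^0\in\mathbb R^n$. Consider the optimal control problem $$\min_{(q,u)}\; J(q,u)=\phi\big(q(T),\dot q(T)\big)+\int_0^T \tfrac12|u(t)|^2\,dt\quad\text{subject to}\quad q(0)=q^0,\ \dot q(0)=v^0,\ \ddot q=f(q)+u \text{ on } [0,T],$$ over $q\in C^3([0,T],\mathbb R^n)$ and $u\in C^1([0,T],N)$, with free final state. Let $(q,u)$ be an optimal solution (a global minimizer) and let $v=\dot q$. For $\lambda_0\in\mathbb R$ let $$\mathcal H(q,v,\lambda_q,\lambda_v,\lambda_0,u)=\lambda_q^\top v+\lambda_v^\top\big(f(q)+u\big)+\lambda_0\,\tfrac12|u|^2 .$$ Call $(\lambda_q,\lambda_v,\lambda_0)$ a Pontryagin multiplier for $(q,u)$ if $\lambda_0\le 0$, $\lambda_q,\lambda_v\in W^{1,\infty}([0,T],\mathbb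 R^n)$, $((\lambda_q,\lambda_v),\lambda_0)\ne 0$, for almost every $t\in[0,T]$ $$\dot q=\partial_{\lambda_q}\mathcal H,\quad \dot v=\partial_{\lambda_v}\mathcal H,\quad \dot\lambda_q=-\partial_q\mathcal H,\quad \dot\lambda_v=-\partial_v\mathcal H,\quad 0=\partial_u\mathcal H,$$ and $\lambda_q(T)=\lambda_0\,\partial_q\phi(q(T),v(T))$, $\lambda_v(T)=\lambda_0\,\partial_v\phi(q(T),v(T))$. Then: 1. There is a Pontryagin multiplier for $(q,u)$ with $\lambda_0=-1$. 2. Every Pontryagin multiplier for $(q,u)$ has $\lambda_0<0$ (there are no abnormal ones). 3. Every Pontryagin multiplier for $(q,u)$ with $\lambda_0=-1$ satisfies, at every $t\in[0,T]$ (with one-sided derivatives at the end points), $$\dot\lambda_q=-\Big(\frac{\partial f}{\partial q}(q)\Big)^{\!\top}\lambda_v,\qquad \dot\lambda_v=-\lambda_q,\qquad 0=u-\lambda_v,$$ and $$\lambda_q(T)=-\frac{\partial\phi}{\partial q}\big(q(T),v(T)\big),\qquad \lambda_v(T)=-\frac{\partial\phi}{\partial v}\big(q(T),v(T)\big).$$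 -/

import Mathlib

/-- The space `ℝⁿ`, in which the configuration space, velocities, controls and adjoints live. -/
abbrev Config (n : ℕ) : Type := EuclideanSpace ℝ (Fin n)

/-- The velocity `q̇` of a curve `q : [0, T] → ℝⁿ` (one-sided at the end points). -/
noncomputable def velocity {n : ℕ} (T : ℝ) (q : ℝ → Config n) (t : ℝ) : Config n :=
  derivWithin q (Set.Icc 0 T) t

/-- The acceleration `q̈` of a curve `q : [0, T] → ℝⁿ` (one-sided at the end points). -/
noncomputable def acceleration {n : ℕ} (T : ℝ) (q : ℝ → Config n) (t : ℝ) : Config n :=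
  derivWithin (velocity T q) (Set.Icc 0 T) t

/-- The pair `(q, u)` is admissible: `q` is `C³` and `u` is `C¹` on `[0, T]`, the control takes
values in `N`, the initial state is `(q₀, v₀)`, and `q̈ = f(q) + u` on `[0, T]`.
The final state is free. -/
structure IsAdmissible {n : ℕ} (T : ℝ) (N : Set (Config n)) (f : Config n → Config n)
    (q₀ v₀ : Config n) (q u : ℝ → Config n) : Prop where
  contDiff_state : ContDiffOn ℝ 3 q (Set.Icc 0 T)
  contDiff_control : ContDiffOn ℝ 1 u (Set.Icc 0 T)
  control_mem : ∀ t ∈ Set.Icc 0 T, u t ∈ N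
  initial_position : q 0 = q₀
  initial_velocity : velocity T q 0 = v₀
  dynamics : ∀ t ∈ Set.Icc 0 T, acceleration T q t = f (q t) + u t

/-- The objective `J(q, u) = φ(q(T), q̇(T)) + ∫₀ᵀ ½ |u(t)|² dt`. -/
noncomputable def cost {n : ℕ} (T : ℝ) (φ : Config n × Config n → ℝ) (q u : ℝ → Config n) : ℝ :=
  φ (q T, velocity T q T) + ∫ t in (0 : ℝ)..T, (1 / 2 : ℝ) * ‖u t‖ ^ 2

/-- The pair `(q, u)` solves the optimal control problem: it is admissible and minimizes the
objective among all admissible pairs. -/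
structure IsOptimal {n : ℕ} (T : ℝ) (N : Set (Config n)) (f : Config n → Config n)
    (φ : Config n × Config n → ℝ) (q₀ v₀ : Config n) (q u : ℝ → Config n) : Prop where
  admissible : IsAdmissible T N f q₀ v₀ q u
  cost_le : ∀ q' u' : ℝ → Config n, IsAdmissible T N f q₀ v₀ q' u' → cost T φ q u ≤ cost T φ q' u'

/-- The control Hamiltonian `⟨λ, F(x, u)⟩ + λ₀ ℓ(x, u)` with state `x = (q, v)`,
adjoint `λ = (lq, lv)`, dynamics `F(x, u) = (v, f(q) + u)` and running cost `ℓ(x, u) = ½ |u|²`. -/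
noncomputable def controlHamiltonian {n : ℕ} (f : Config n → Config n)
    (q v lq lv : Config n) (l₀ : ℝ) (u : Config n) : ℝ :=
  inner ℝ lq v + inner ℝ lv (f q + u) + l₀ * ((1 / 2 : ℝ) * ‖u‖ ^ 2)

/-- The gradient of the end cost `φ(q, v)` with respect to the position `q`. -/
noncomputable def gradPos {n : ℕ} (φ : Config n × Config n → ℝ) (q v : Config n) : Config n :=
  gradient (fun a : Config n => φ (a, v)) q

/-- The gradient of the end cost `φ(q, v)` with respect to the velocity `v`. -/
noncomputable def gradVel {n : ℕ} (φ : Config n × Config n → ℝ) (q v : Config n) : Config n :=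
  gradient (fun b : Config n => φ (q, b)) v

/-- The conditions of Pontryagin's maximum principle for the curve `(q, q̇)`, the control `u`, the
adjoint curve `(lq, lv)` and the multiplier `l₀`: `l₀ ≤ 0`, `((lq, lv), l₀) ≠ 0`, the adjoints are
of class `W^{1,∞}` (that is, Lipschitz) on `[0, T]`, the generalized Hamiltonian system holds almost
everywhere on `[0, T]`, and so do the transversality conditions for fixed initial and free final
state. -/
structure IsPontryaginLift {n : ℕ} (T : ℝ) (f : Config n → Config n)
    (φ : Config n × Config n → ℝ) (q u lq lv : ℝ → Config n) (l₀ : ℝ) : Prop where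
  multiplier_nonpos : l₀ ≤ 0
  nontrivial : l₀ ≠ 0 ∨ ∃ t ∈ Set.Icc 0 T, lq t ≠ 0 ∨ lv t ≠ 0
  lipschitz_lq : ∃ K : NNReal, LipschitzOnWith K lq (Set.Icc 0 T)
  lipschitz_lv : ∃ K : NNReal, LipschitzOnWith K lv (Set.Icc 0 T)
  state_q : ∀ᵐ t ∂(MeasureTheory.volume.restrict (Set.Icc 0 T)),
    HasDerivAt q (gradient
      (fun a => controlHamiltonian f (q t) (velocity T q t) a (lv t) l₀ (u t)) (lq t)) t
  state_v : ∀ᵐ t ∂(MeasureTheory.volume.restrict (Set.Icc 0 T)),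
    HasDerivAt (velocity T q) (gradient
      (fun a => controlHamiltonian f (q t) (velocity T q t) (lq t) a l₀ (u t)) (lv t)) t
  adjoint_q : ∀ᵐ t ∂(MeasureTheory.volume.restrict (Set.Icc 0 T)),
    HasDerivAt lq (-gradient
      (fun a => controlHamiltonian f a (velocity T q t) (lq t) (lv t) l₀ (u t)) (q t)) t
  adjoint_v : ∀ᵐ t ∂(MeasureTheory.volume.restrict (Set.Icc 0 T)),
    HasDerivAt lv (-gradient
      (fun a => controlHamiltonian f (q t) a (lq t) (lv t) l₀ (u t)) (velocity T q t)) t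
  stationary_u : ∀ᵐ t ∂(MeasureTheory.volume.restrict (Set.Icc 0 T)),
    0 = gradient
      (fun a => controlHamiltonian f (q t) (velocity T q t) (lq t) (lv t) l₀ a) (u t)
  transversality_q : lq T = l₀ • gradPos φ (q T) (velocity T q T)
  transversality_v : lv T = l₀ • gradVel φ (q T) (velocity T q T)

/-!
The dynamics `q̈ = f(q) + u` are fully actuated, so no differential equation has to be solved to vary
a trajectory: any `C³` curve `η` with `η(0) = η̇(0) = 0` gives the admissible pairs
`q + x η`, `u + x η̈ + f(q) - f(q + x η)` for small `x`, the control staying in the open set `N`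
because `u([0, T])` is compact (`IsAdmissible.add_smul`). Along this family the cost has a minimum
at `x = 0`, which yields (`IsOptimal.first_variation_eq_zero`)
`Dφ(q(T), q̇(T))(η(T), η̇(T)) + ∫ ⟨u, η̈ - Df(q) η⟩ = 0`.

Let `P` be the primitive of `-Df(q)ᵀ u` with `P(T) = -∂φ/∂q`. Integrating by parts and writing
`w = η̇`, the first variation becomes `∫ ⟨u̇ + P, w⟩ = ⟨u(T) + ∂φ/∂v, w(T)⟩` for all `w` with
`w(0) = 0`. The fundamental lemma of the calculus of variations, in the form
`eq_zero_of_integral_inner_eq_inner_end`, gives `u̇ = -P` and `u(T) = -∂φ/∂v`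
(`IsOptimal.euler_lagrange`), so that `(λ_q, λ_v) = (P, u)` is a Pontryagin lift with `λ₀ = -1`.

Conversely, stationarity in the control of an arbitrary lift reads `λ_v = -λ₀ u`, almost everywhere
and hence everywhere by continuity. If `λ₀ = 0` then `λ_v = 0`, so `λ_q = -λ̇_v = 0`, against
nontriviality (`IsPontryaginLift.multiplier_neg`). Finally, a Lipschitz function whose derivative
agrees almost everywhere with a continuous function is differentiable everywhere
(`LipschitzOnWith.hasDerivWithinAt_Icc_of_ae_hasDerivAt`); this upgrades the adjoint equations to
every point of `[0, T]`.
-/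

/-! ### Calculus of variations on an interval -/

/-- Differentiation under the integral sign when the integrand and its derivative in the parameter
are jointly continuous. -/
theorem hasDerivAt_integral_of_continuous {F F' : ℝ → ℝ → ℝ} {a b : ℝ}
    (hF : Continuous (Function.uncurry F)) (hF' : Continuous (Function.uncurry F'))
    (hd : ∀ x t, HasDerivAt (fun x => F x t) (F' x t) x) (x₀ : ℝ) :
    HasDerivAt (fun x => ∫ t in a..b, F x t) (∫ t in a..b, F' x₀ t) x₀ := by
  have hK : IsCompact (Set.Icc (x₀ - 1) (x₀ + 1) ×ˢ Set.uIcc a b) :=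
    isCompact_Icc.prod isCompact_uIcc
  obtain ⟨C, hC⟩ := hK.exists_bound_of_continuousOn hF'.continuousOn
  have hc : ∀ x, Continuous (F x) := fun x => hF.comp (Continuous.prodMk_right x)
  have hc' : ∀ x, Continuous (F' x) := fun x => hF'.comp (Continuous.prodMk_right x)
  refine (intervalIntegral.hasDerivAt_integral_of_dominated_loc_of_deriv_le
    (bound := fun _ => C) (F := F) (F' := F') (s := Set.Icc (x₀ - 1) (x₀ + 1))
    (Icc_mem_nhds (by linarith) (by linarith))
    (Filter.Eventually.of_forall fun x => (hc x).aestronglyMeasurable)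
    ((hc x₀).intervalIntegrable _ _) (hc' x₀).aestronglyMeasurable ?_
    intervalIntegrable_const ?_).2
  · exact Filter.Eventually.of_forall fun t ht x hx =>
      hC (x, t) ⟨hx, Set.uIoc_subset_uIcc ht⟩
  · exact Filter.Eventually.of_forall fun t _ x _ => hd x t

section
variable {E : Type*} [NormedAddCommGroup E] [InnerProductSpace ℝ E]

/-- The control energy of the perturbed trajectory `Q + x η`, differentiated at `x = 0`; here `η₂`
plays the role of `η̈`. -/
theorem hasDerivAt_integral_half_norm_sq_variation {f : E → E} (hf : ContDiff ℝ 1 f)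
    {U Q η η₂ : ℝ → E} (hU : Continuous U) (hQ : Continuous Q) (hη : Continuous η)
    (hη₂ : Continuous η₂) (T : ℝ) :
    HasDerivAt (fun x : ℝ => ∫ t in (0 : ℝ)..T,
        (1 / 2 : ℝ) * ‖U t + x • η₂ t + (f (Q t) - f (Q t + x • η t))‖ ^ 2)
      (∫ t in (0 : ℝ)..T, inner ℝ (U t) (η₂ t - fderiv ℝ f (Q t) (η t))) 0 := by
  have hfc := hf.continuous
  have hdf : Continuous (fderiv ℝ f) := hf.continuous_fderiv one_ne_zero
  have key := hasDerivAt_integral_of_continuous (a := 0) (b := T)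
    (F := fun x t => (1 / 2 : ℝ) * ‖U t + x • η₂ t + (f (Q t) - f (Q t + x • η t))‖ ^ 2)
    (F' := fun x t => inner ℝ (U t + x • η₂ t + (f (Q t) - f (Q t + x • η t)))
      (η₂ t - fderiv ℝ f (Q t + x • η t) (η t)))
    (by unfold Function.uncurry; fun_prop)
    (by
      unfold Function.uncurry
      refine Continuous.inner (by fun_prop) (Continuous.sub (by fun_prop) ?_)
      exact (hdf.comp (by fun_prop)).clm_apply (by fun_prop)) ?_ 0
  · simpa using key
  · intro x t
    have h1 : HasDerivAt (fun x : ℝ => Q t + x • η t) (η t) x := by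
      simpa using ((hasDerivAt_id x).smul_const (η t)).const_add (Q t)
    have h2 : HasDerivAt (fun x : ℝ => f (Q t + x • η t)) (fderiv ℝ f (Q t + x • η t) (η t)) x :=
      ((hf.differentiable one_ne_zero) _).hasFDerivAt.comp_hasDerivAt x h1
    have h3 : HasDerivAt (fun x : ℝ => U t + x • η₂ t) (η₂ t) x := by
      simpa using ((hasDerivAt_id x).smul_const (η₂ t)).const_add (U t)
    have h4 := (h3.add (h2.const_sub (f (Q t)))).norm_sq.const_mul (1 / 2 : ℝ)
    convert! h4 using 1
    simp only [Pi.add_apply, ← sub_eq_add_neg]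
    ring

/-- The fundamental lemma of the calculus of variations with a free right end point. Test curves
compactly supported in `(0, T)` give `h = 0`, and then `w(t) = t c` gives `c = 0`. -/
theorem eq_zero_of_integral_inner_eq_inner_end [CompleteSpace E] {T : ℝ} (hT : 0 < T) {h : ℝ → E}
    (hh : ContinuousOn h (Set.Icc 0 T)) {c : E}
    (H : ∀ w : ℝ → E, ContDiff ℝ 2 w → w 0 = 0 →
      ∫ t in (0 : ℝ)..T, inner ℝ (h t) (w t) = inner ℝ c (w T)) :
    (∀ t ∈ Set.Icc 0 T, h t = 0) ∧ c = 0 := by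
  have hae : ∀ᵐ t : ℝ, t ∈ Set.Ioo 0 T → h t = 0 := by
    refine isOpen_Ioo.ae_eq_zero_of_integral_contDiff_smul_eq_zero
      ((hh.mono Set.Ioo_subset_Icc_self).locallyIntegrableOn measurableSet_Ioo) ?_
    intro g hg hgc hgs
    have hz : ∀ t, t ∉ Set.Ioo 0 T → g t = 0 := fun t ht =>
      image_eq_zero_of_notMem_tsupport fun h' => ht (hgs h')
    have h0 : ∀ t, t ∉ Set.Ioc 0 T → g t • h t = 0 := fun t ht => by
      rw [hz t fun h' => ht (Set.Ioo_subset_Ioc_self h'), zero_smul]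
    rw [← MeasureTheory.setIntegral_eq_integral_of_forall_compl_eq_zero h0,
      ← intervalIntegral.integral_of_le hT.le]
    refine ext_inner_right ℝ fun e => ?_
    have hi : IntervalIntegrable (fun t => g t • h t) MeasureTheory.volume 0 T :=
      (hg.continuous.continuousOn.smul hh).intervalIntegrable_of_Icc hT.le
    have h1 := H (fun t => g t • e)
      ((contDiff_infty.1 hg 2).smul contDiff_const) (by simp [hz 0 (by simp)])
    rw [hz T (by simp), zero_smul, inner_zero_right] at h1
    rw [inner_zero_left, real_inner_comm]
    refine Eq.trans ?_ h1
    refine ((innerSL ℝ e).intervalIntegral_comp_comm hi).symm.trans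
      (intervalIntegral.integral_congr fun t _ => ?_)
    simp [inner_smul_right, real_inner_comm]
  have h0 : ∀ t ∈ Set.Icc 0 T, h t = 0 := by
    have := MeasureTheory.Measure.eqOn_Icc_of_ae_eq (μ := MeasureTheory.volume) hT.ne
      (f := h) (g := fun _ => 0)
      (by
        rw [← MeasureTheory.Measure.restrict_congr_set MeasureTheory.Ioo_ae_eq_Icc]
        exact (MeasureTheory.ae_restrict_iff' measurableSet_Ioo).2 hae) hh continuousOn_const
    exact this
  refine ⟨h0, ?_⟩
  have h1 := H (fun t => t • c) (contDiff_id.smul contDiff_const) (by simp)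
  rw [intervalIntegral.integral_congr (g := fun _ => (0 : ℝ))] at h1
  · simpa [inner_smul_right, hT.ne'] using h1.symm
  · intro t ht
    rw [Set.uIcc_of_le hT.le] at ht
    simp [h0 t ht]

/-- A Lipschitz curve whose derivative agrees almost everywhere with a continuous function has that
function as its derivative everywhere: it is absolutely continuous, hence the integral of its
derivative. -/
theorem LipschitzOnWith.hasDerivWithinAt_Icc_of_ae_hasDerivAt [CompleteSpace E] {T : ℝ}
    {K : NNReal} {g g' : ℝ → E} (hg : LipschitzOnWith K g (Set.Icc 0 T))
    (hg' : ContinuousOn g' (Set.Icc 0 T))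
    (hd : ∀ᵐ t ∂(MeasureTheory.volume.restrict (Set.Icc 0 T)), HasDerivAt g (g' t) t) :
    ∀ t ∈ Set.Icc 0 T, HasDerivWithinAt g (g' t) (Set.Icc 0 T) t := by
  have hint : ∀ t ∈ Set.Icc 0 T, IntervalIntegrable g' MeasureTheory.volume 0 t := fun t ht =>
    (hg'.mono (Set.Icc_subset_Icc_right ht.2)).intervalIntegrable_of_Icc ht.1
  have hd' : ∀ᵐ t, t ∈ Set.Icc 0 T → HasDerivAt g (g' t) t :=
    (MeasureTheory.ae_restrict_iff' measurableSet_Icc).1 hd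
  have key : ∀ t ∈ Set.Icc 0 T, g t = g 0 + ∫ s in (0 : ℝ)..t, g' s := by
    intro t ht
    rw [← sub_eq_iff_eq_add']
    refine ext_inner_left ℝ fun e => ?_
    have hac : AbsolutelyContinuousOnInterval (fun s => inner ℝ e (g s)) 0 t := by
      refine LipschitzOnWith.absolutelyContinuousOnInterval
        (K := ‖innerSL ℝ e‖₊ * K) ?_
      rw [Set.uIcc_of_le ht.1]
      exact (innerSL ℝ e).lipschitz.comp_lipschitzOnWith
        (hg.mono (Set.Icc_subset_Icc_right ht.2))
    have h1 := hac.integral_deriv_eq_sub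
    rw [inner_sub_right, ← h1]
    refine Eq.trans ?_ ((innerSL ℝ e).intervalIntegral_comp_comm (hint t ht))
    refine intervalIntegral.integral_congr_ae ?_
    filter_upwards [hd'] with s hs hst
    rw [Set.uIoc_of_le ht.1] at hst
    exact ((innerSL ℝ e).hasFDerivAt.comp_hasDerivAt s
      (hs ⟨hst.1.le, hst.2.trans ht.2⟩)).deriv
  intro t ht
  have : Fact (t ∈ Set.Icc 0 T) := ⟨ht⟩
  have h2 : HasDerivWithinAt (fun u => ∫ s in (0 : ℝ)..u, g' s) (g' t) (Set.Icc 0 T) t :=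
    intervalIntegral.integral_hasDerivWithinAt_right (hint t ht)
      (hg'.stronglyMeasurableAtFilter_nhdsWithin measurableSet_Icc t) (hg' t ht)
  exact (h2.const_add (g 0)).congr key (key t ht)

end

/-! ### Variations of admissible pairs and the first variation of the cost -/

theorem ContDiff.deriv_of_add_one_le {E : Type*} [NormedAddCommGroup E] [NormedSpace ℝ E]
    {m k : WithTop ℕ∞} {g : ℝ → E} (hg : ContDiff ℝ k g) (hmk : m + 1 ≤ k) :
    ContDiff ℝ m (deriv g) :=
  (contDiff_succ_iff_deriv.1 (hg.of_le hmk)).2.2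

section Curves
variable {n : ℕ} {T : ℝ} {N : Set (Config n)} {f : Config n → Config n} {q₀ v₀ : Config n}
  {q u η : ℝ → Config n}

theorem ContDiffOn.hasDerivWithinAt_velocity {k : WithTop ℕ∞} (hq : ContDiffOn ℝ k q (Set.Icc 0 T))
    (hk : k ≠ 0) {t : ℝ} (ht : t ∈ Set.Icc 0 T) :
    HasDerivWithinAt q (velocity T q t) (Set.Icc 0 T) t :=
  ((hq t ht).differentiableWithinAt hk).hasDerivWithinAt

theorem ContDiffOn.velocity {k m : WithTop ℕ∞} (hq : ContDiffOn ℝ k q (Set.Icc 0 T))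
    (hT : 0 < T) (hm : m + 1 ≤ k) : ContDiffOn ℝ m (velocity T q) (Set.Icc 0 T) :=
  hq.derivWithin (uniqueDiffOn_Icc hT) hm

theorem velocity_add_smul (hT : 0 < T) (hq : ContDiffOn ℝ 3 q (Set.Icc 0 T)) (hη : ContDiff ℝ 3 η)
    (x : ℝ) {t : ℝ} (ht : t ∈ Set.Icc 0 T) :
    velocity T (fun t => q t + x • η t) t = velocity T q t + x • deriv η t :=
  ((hq.hasDerivWithinAt_velocity (by norm_num) ht).add
    (((hη.differentiable (by norm_num) t).hasDerivAt.hasDerivWithinAt).const_smul x)).derivWithin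
    (uniqueDiffOn_Icc hT t ht)

theorem acceleration_add_smul (hT : 0 < T) (hq : ContDiffOn ℝ 3 q (Set.Icc 0 T))
    (hη : ContDiff ℝ 3 η) (x : ℝ) {t : ℝ} (ht : t ∈ Set.Icc 0 T) :
    acceleration T (fun t => q t + x • η t) t = acceleration T q t + x • deriv (deriv η) t := by
  have hη' : ContDiff ℝ 2 (deriv η) := hη.deriv_of_add_one_le (by norm_num)
  have h2 : ContDiffOn ℝ 2 (velocity T q) (Set.Icc 0 T) := hq.velocity hT (by norm_num)
  have h := (h2.hasDerivWithinAt_velocity (by norm_num) ht).add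
    (((hη'.differentiable (by norm_num) t).hasDerivAt.hasDerivWithinAt).const_smul x)
  exact (derivWithin_congr (fun s hs => velocity_add_smul hT hq hη x hs)
    (velocity_add_smul hT hq hη x ht)).trans (h.derivWithin (uniqueDiffOn_Icc hT t ht))

/-- Adding `x η` to the state keeps the pair admissible when the control absorbs the change of
acceleration and of force. -/
theorem IsAdmissible.add_smul (hT : 0 < T) (hf : ContDiff ℝ 1 f)
    (h : IsAdmissible T N f q₀ v₀ q u) (hη : ContDiff ℝ 3 η) (hη0 : η 0 = 0)
    (hη0' : deriv η 0 = 0) {x : ℝ}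
    (hN : ∀ t ∈ Set.Icc 0 T,
      u t + x • deriv (deriv η) t + (f (q t) - f (q t + x • η t)) ∈ N) :
    IsAdmissible T N f q₀ v₀ (fun t => q t + x • η t)
      (fun t => u t + x • deriv (deriv η) t + (f (q t) - f (q t + x • η t))) := by
  have hq := h.contDiff_state
  have h0 : (0 : ℝ) ∈ Set.Icc 0 T := ⟨le_rfl, hT.le⟩
  have hη2 : ContDiff ℝ 1 (deriv (deriv η)) :=
    (hη.deriv_of_add_one_le (m := 2) (by norm_num)).deriv_of_add_one_le (by norm_num)
  have hqx : ContDiffOn ℝ 3 (fun t => q t + x • η t) (Set.Icc 0 T) :=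
    hq.add (hη.const_smul x).contDiffOn
  refine ⟨hqx, ?_, hN, ?_, ?_, ?_⟩
  · exact (h.contDiff_control.add (hη2.const_smul x).contDiffOn).add
      ((hf.comp_contDiffOn (hq.of_le (by norm_num))).sub
        (hf.comp_contDiffOn (hqx.of_le (by norm_num))))
  · simp [hη0, h.initial_position]
  · simp [velocity_add_smul hT hq hη x h0, hη0', h.initial_velocity]
  · intro t ht
    rw [acceleration_add_smul hT hq hη x ht, h.dynamics t ht]
    abel

/-- The first variation of the cost vanishes at an optimal pair, in every direction `η` compatible
with the initial conditions. -/
theorem IsOptimal.first_variation_eq_zero (hT : 0 < T) (hN : IsOpen N) (hf : ContDiff ℝ 1 f)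
    {φ : Config n × Config n → ℝ} (hφ : ContDiff ℝ 1 φ) (h : IsOptimal T N f φ q₀ v₀ q u)
    (hη : ContDiff ℝ 3 η) (hη0 : η 0 = 0) (hη0' : deriv η 0 = 0) :
    fderiv ℝ φ (q T, velocity T q T) (η T, deriv η T) +
      ∫ t in (0 : ℝ)..T, inner ℝ (u t) (deriv (deriv η) t - fderiv ℝ f (q t) (η t)) = 0 := by
  have hq := h.admissible.contDiff_state
  have hTT : T ∈ Set.Icc 0 T := ⟨hT.le, le_rfl⟩
  have hη2 : Continuous (deriv (deriv η)) :=
    ((hη.deriv_of_add_one_le (m := 2) (by norm_num)).deriv_of_add_one_le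
      (m := 1) (by norm_num)).continuous
  have hηc : Continuous η := hη.continuous
  have hfc : Continuous f := hf.continuous
  -- Outside `[0, T]` the curves `q` and `u` are arbitrary; the integrands are made jointly
  -- continuous by extending both continuously to the whole line.
  obtain ⟨Q, hQ, hQq⟩ : ∃ Q : ℝ → Config n, Continuous Q ∧ ∀ t ∈ Set.Icc 0 T, Q t = q t :=
    ⟨_, hq.continuousOn.domRestrict.Icc_extend' (h := hT.le),
      fun t ht => Set.IccExtend_of_mem hT.le _ ht⟩
  obtain ⟨U, hU, hUu⟩ : ∃ U : ℝ → Config n, Continuous U ∧ ∀ t ∈ Set.Icc 0 T, U t = u t :=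
    ⟨_, h.admissible.contDiff_control.continuousOn.domRestrict.Icc_extend' (h := hT.le),
      fun t ht => Set.IccExtend_of_mem hT.le _ ht⟩
  have hmem : ∀ᶠ x in nhds (0 : ℝ), ∀ t ∈ Set.Icc 0 T,
      U t + x • deriv (deriv η) t + (f (Q t) - f (Q t + x • η t)) ∈ N := by
    refine isCompact_Icc.eventually_forall_of_forall_eventually fun t ht => ?_
    have hc : Continuous fun z : ℝ × ℝ =>
        U z.2 + z.1 • deriv (deriv η) z.2 + (f (Q z.2) - f (Q z.2 + z.1 • η z.2)) := by
      fun_prop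
    refine hc.continuousAt.eventually_mem (hN.mem_nhds ?_)
    simpa [hUu t ht] using h.admissible.control_mem t ht
  have hmin : IsLocalMin (fun x : ℝ =>
      φ (q T + x • η T, velocity T q T + x • deriv η T) + ∫ t in (0 : ℝ)..T,
        (1 / 2 : ℝ) * ‖U t + x • deriv (deriv η) t + (f (Q t) - f (Q t + x • η t))‖ ^ 2) 0 := by
    have hcost : ∀ x : ℝ, cost T φ (fun t => q t + x • η t)
        (fun t => u t + x • deriv (deriv η) t + (f (q t) - f (q t + x • η t))) =
        φ (q T + x • η T, velocity T q T + x • deriv η T) + ∫ t in (0 : ℝ)..T,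
          (1 / 2 : ℝ) * ‖U t + x • deriv (deriv η) t + (f (Q t) - f (Q t + x • η t))‖ ^ 2 := by
      intro x
      rw [cost, velocity_add_smul hT hq hη x hTT]
      congr 1
      refine intervalIntegral.integral_congr fun t ht => ?_
      rw [Set.uIcc_of_le hT.le] at ht
      simp only [hQq t ht, hUu t ht]
    filter_upwards [hmem] with x hx
    rw [← hcost, ← hcost]
    have := h.cost_le _ _ (h.admissible.add_smul hT hf hη hη0 hη0' (x := x) fun t ht => by
      simpa only [hQq t ht, hUu t ht] using hx t ht)
    simpa using this
  have hd1 : HasDerivAt (fun x : ℝ => φ (q T + x • η T, velocity T q T + x • deriv η T))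
      (fderiv ℝ φ (q T, velocity T q T) (η T, deriv η T)) 0 := by
    have h1 : HasDerivAt (fun x : ℝ => (q T + x • η T, velocity T q T + x • deriv η T))
        (η T, deriv η T) 0 := by
      refine HasDerivAt.prodMk ?_ ?_
      · simpa using ((hasDerivAt_id (0 : ℝ)).smul_const (η T)).const_add (q T)
      · simpa using ((hasDerivAt_id (0 : ℝ)).smul_const (deriv η T)).const_add (velocity T q T)
    have h2 := ((hφ.differentiable one_ne_zero)
      (q T + (0 : ℝ) • η T, velocity T q T + (0 : ℝ) • deriv η T)).hasFDerivAt.comp_hasDerivAt 0 h1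
    simpa [Function.comp_def] using h2
  have := hmin.hasDerivAt_eq_zero
    (hd1.add (hasDerivAt_integral_half_norm_sq_variation hf hU hQ hηc hη2 T))
  refine Eq.trans ?_ this
  congr 1
  refine intervalIntegral.integral_congr fun t ht => ?_
  rw [Set.uIcc_of_le hT.le] at ht
  simp only [hQq t ht, hUu t ht]

end Curves

/-! ### Gradients of the Hamiltonian and of the end cost -/

section Gradients

theorem gradient_inner_right_add_const {E : Type*} [NormedAddCommGroup E] [InnerProductSpace ℝ E]
    [CompleteSpace E] (w : E) (c : ℝ) (x : E) :
    gradient (fun a : E => inner ℝ w a + c) x = w := by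
  refine HasGradientAt.gradient ?_
  rw [hasGradientAt_iff_hasFDerivAt]
  exact ((InnerProductSpace.toDual ℝ E w).hasFDerivAt).add_const c

theorem inner_gradPos_add_inner_gradVel {n : ℕ} {φ : Config n × Config n → ℝ}
    (hφ : Differentiable ℝ φ) (q v a b : Config n) :
    inner ℝ (gradPos φ q v) a + inner ℝ (gradVel φ q v) b = fderiv ℝ φ (q, v) (a, b) := by
  have h1 : HasFDerivAt (fun a => φ (a, v)) _ q :=
    (hφ (q, v)).hasFDerivAt.comp q (hasFDerivAt_prodMk_left q v)
  have h2 : HasFDerivAt (fun b => φ (q, b)) _ v :=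
    (hφ (q, v)).hasFDerivAt.comp v (hasFDerivAt_prodMk_right q v)
  rw [gradPos, gradVel, gradient, gradient, InnerProductSpace.toDual_symm_apply,
    InnerProductSpace.toDual_symm_apply, h1.fderiv, h2.fderiv]
  simp [← map_add]

variable {n : ℕ} (f : Config n → Config n) (q v lq lv : Config n) (l₀ : ℝ) (u : Config n)

theorem gradient_controlHamiltonian_adjoint_pos :
    gradient (fun a => controlHamiltonian f q v a lv l₀ u) lq = v := by
  convert gradient_inner_right_add_const v
    (inner ℝ lv (f q + u) + l₀ * ((1 / 2 : ℝ) * ‖u‖ ^ 2)) lq using 3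
  rw [controlHamiltonian, real_inner_comm, add_assoc]

theorem gradient_controlHamiltonian_adjoint_vel :
    gradient (fun a => controlHamiltonian f q v lq a l₀ u) lv = f q + u := by
  convert gradient_inner_right_add_const (f q + u)
    (inner ℝ lq v + l₀ * ((1 / 2 : ℝ) * ‖u‖ ^ 2)) lv using 3
  rw [controlHamiltonian, real_inner_comm (f q + u)]
  ring

theorem gradient_controlHamiltonian_vel :
    gradient (fun a => controlHamiltonian f q a lq lv l₀ u) v = lq := by
  convert gradient_inner_right_add_const lq
    (inner ℝ lv (f q + u) + l₀ * ((1 / 2 : ℝ) * ‖u‖ ^ 2)) v using 3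
  rw [controlHamiltonian, add_assoc]

theorem gradient_controlHamiltonian_control :
    gradient (fun a => controlHamiltonian f q v lq lv l₀ a) u = lv + l₀ • u := by
  refine HasGradientAt.gradient ?_
  rw [hasGradientAt_iff_hasFDerivAt]
  have h1 : HasFDerivAt (fun a : Config n => inner ℝ lv (f q + a)) (innerSL ℝ lv) u := by
    simpa [inner_add_right] using
      ((innerSL ℝ lv).hasFDerivAt (x := u)).const_add (inner ℝ lv (f q))
  have h2 := (((hasStrictFDerivAt_norm_sq u).hasFDerivAt.const_mul (1 / 2 : ℝ)).const_mul l₀)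
  convert! (h1.const_add (inner ℝ lq v)).add h2 using 1
  ext a
  simp

theorem gradient_controlHamiltonian_pos {f : Config n → Config n} (hf : DifferentiableAt ℝ f q) :
    gradient (fun a => controlHamiltonian f a v lq lv l₀ u) q =
      ContinuousLinearMap.adjoint (fderiv ℝ f q) lv := by
  refine HasGradientAt.gradient ?_
  rw [hasGradientAt_iff_hasFDerivAt]
  have h1 := (innerSL ℝ lv).hasFDerivAt.comp q (hf.hasFDerivAt.add_const u)
  convert! (h1.const_add (inner ℝ lq v)).add_const (l₀ * ((1 / 2 : ℝ) * ‖u‖ ^ 2)) using 1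
  ext a
  simp [ContinuousLinearMap.adjoint_inner_left]

end Gradients

/-! ### Regularity of Pontryagin lifts -/

section Lift
variable {n : ℕ} {T : ℝ} {f : Config n → Config n} {φ : Config n × Config n → ℝ}
  {q u lq lv : ℝ → Config n} {l₀ : ℝ}

theorem continuousOn_adjoint_fderiv_apply {s : Set ℝ} (hf : ContDiff ℝ 1 f)
    (hq : ContinuousOn q s) (hl : ContinuousOn lv s) :
    ContinuousOn (fun t => ContinuousLinearMap.adjoint (fderiv ℝ f (q t)) (lv t)) s :=
  ((ContinuousLinearMap.adjoint (𝕜 := ℝ) (E := Config n) (F := Config n)).continuous.comp_continuousOn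
    ((hf.continuous_fderiv one_ne_zero).comp_continuousOn hq)).clm_apply hl

/-- Stationarity in the control, at every time. -/
theorem IsPontryaginLift.adjoint_eq (h : IsPontryaginLift T f φ q u lq lv l₀) (hT : 0 < T)
    (hu : ContinuousOn u (Set.Icc 0 T)) : ∀ t ∈ Set.Icc 0 T, lv t = -l₀ • u t := by
  obtain ⟨K, hK⟩ := h.lipschitz_lv
  refine MeasureTheory.Measure.eqOn_Icc_of_ae_eq MeasureTheory.volume hT.ne ?_ hK.continuousOn
    (hu.const_smul (-l₀) :)
  filter_upwards [h.stationary_u] with t ht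
  rw [gradient_controlHamiltonian_control] at ht
  rw [neg_smul]
  exact eq_neg_of_add_eq_zero_left ht.symm

theorem IsPontryaginLift.hasDerivWithinAt_adjoint_vel (h : IsPontryaginLift T f φ q u lq lv l₀) :
    ∀ t ∈ Set.Icc 0 T, HasDerivWithinAt lv (-(lq t)) (Set.Icc 0 T) t := by
  obtain ⟨K, hK⟩ := h.lipschitz_lv
  obtain ⟨K', hK'⟩ := h.lipschitz_lq
  refine hK.hasDerivWithinAt_Icc_of_ae_hasDerivAt hK'.continuousOn.neg ?_
  filter_upwards [h.adjoint_v] with t ht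
  rwa [gradient_controlHamiltonian_vel] at ht

theorem IsPontryaginLift.hasDerivWithinAt_adjoint_pos (h : IsPontryaginLift T f φ q u lq lv l₀)
    (hf : ContDiff ℝ 1 f) (hq : ContinuousOn q (Set.Icc 0 T)) :
    ∀ t ∈ Set.Icc 0 T, HasDerivWithinAt lq
      (-(ContinuousLinearMap.adjoint (fderiv ℝ f (q t)) (lv t))) (Set.Icc 0 T) t := by
  obtain ⟨K, hK⟩ := h.lipschitz_lv
  obtain ⟨K', hK'⟩ := h.lipschitz_lq
  refine hK'.hasDerivWithinAt_Icc_of_ae_hasDerivAt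
    (continuousOn_adjoint_fderiv_apply hf hq hK.continuousOn).neg ?_
  filter_upwards [h.adjoint_q] with t ht
  rwa [gradient_controlHamiltonian_pos _ _ _ _ _ _ (hf.differentiable one_ne_zero _)] at ht

/-- There are no abnormal lifts: `λ₀ = 0` would force both adjoints to vanish. -/
theorem IsPontryaginLift.multiplier_neg (h : IsPontryaginLift T f φ q u lq lv l₀) (hT : 0 < T)
    (hu : ContinuousOn u (Set.Icc 0 T)) : l₀ < 0 := by
  refine h.multiplier_nonpos.lt_of_ne fun h0 => ?_
  have hv : ∀ t ∈ Set.Icc 0 T, lv t = 0 := fun t ht => by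
    rw [h.adjoint_eq hT hu t ht, h0, neg_zero, zero_smul]
  have hq : ∀ t ∈ Set.Icc 0 T, lq t = 0 := fun t ht => by
    have h1 : HasDerivWithinAt lv 0 (Set.Icc 0 T) t :=
      (hasDerivWithinAt_const t _ 0).congr hv (hv t ht)
    exact neg_eq_zero.1
      ((uniqueDiffOn_Icc hT t ht).eq_deriv _ (h.hasDerivWithinAt_adjoint_vel t ht) h1)
  rcases h.nontrivial with h1 | ⟨t, ht, h1 | h1⟩
  exacts [h1 h0, h1 (hq t ht), h1 (hv t ht)]

end Lift

/-! ### The Euler–Lagrange equation and existence of a lift -/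

theorem ae_restrict_Icc_of_forall_mem_Ioo {a b : ℝ} {p : ℝ → Prop}
    (h : ∀ t ∈ Set.Ioo a b, p t) : ∀ᵐ t ∂(MeasureTheory.volume.restrict (Set.Icc a b)), p t := by
  rw [← MeasureTheory.Measure.restrict_congr_set MeasureTheory.Ioo_ae_eq_Icc]
  exact MeasureTheory.ae_restrict_of_forall_mem measurableSet_Ioo h

section Existence

/-- A continuous function on `[a, b]` has a primitive there with prescribed value at `b`. -/
theorem exists_hasDerivWithinAt_Icc {E : Type*} [NormedAddCommGroup E] [NormedSpace ℝ E]
    [CompleteSpace E] {a b : ℝ} {A : ℝ → E} (hA : ContinuousOn A (Set.Icc a b))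
    (c : E) :
    ∃ P : ℝ → E, P b = c ∧ ∀ t ∈ Set.Icc a b, HasDerivWithinAt P (A t) (Set.Icc a b) t := by
  refine ⟨fun t => c + ∫ s in b..t, A s, by simp, fun t ht => ?_⟩
  have : Fact (t ∈ Set.Icc a b) := ⟨ht⟩
  refine (intervalIntegral.integral_hasDerivWithinAt_right ?_
      (hA.stronglyMeasurableAtFilter_nhdsWithin measurableSet_Icc t) (hA t ht)).const_add c
  exact ((hA.mono (Set.Icc_subset_Icc_left ht.1)).intervalIntegrable_of_Icc ht.2).symm

theorem exists_lipschitzOnWith_Icc_of_hasDerivWithinAt {E : Type*} [NormedAddCommGroup E]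
    [NormedSpace ℝ E] {a b : ℝ} {P A : ℝ → E} (hA : ContinuousOn A (Set.Icc a b))
    (hP : ∀ t ∈ Set.Icc a b, HasDerivWithinAt P (A t) (Set.Icc a b) t) :
    ∃ K : NNReal, LipschitzOnWith K P (Set.Icc a b) := by
  obtain ⟨C, hC⟩ := isCompact_Icc.exists_bound_of_continuousOn hA
  refine ⟨C.toNNReal, (convex_Icc a b).lipschitzOnWith_of_nnnorm_hasDerivWithin_le hP
    fun t ht => ?_⟩
  rw [← NNReal.coe_le_coe, coe_nnnorm]
  exact (hC t ht).trans (Real.le_coe_toNNReal C)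

variable {n : ℕ} {T : ℝ} {N : Set (Config n)} {f : Config n → Config n}
  {φ : Config n × Config n → ℝ} {q₀ v₀ : Config n} {q u P : ℝ → Config n}

/-- The Euler–Lagrange equation `u̇ = -P` and the natural boundary condition `u(T) = -∂φ/∂v` of an
optimal pair, where `P` is the position adjoint: the solution of `Ṗ = -Df(q)ᵀ u` with
`P(T) = -∂φ/∂q`. -/
theorem IsOptimal.euler_lagrange (hT : 0 < T) (hN : IsOpen N) (hf : ContDiff ℝ 1 f)
    (hφ : ContDiff ℝ 1 φ) (h : IsOptimal T N f φ q₀ v₀ q u)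
    (hPT : P T = -gradPos φ (q T) (velocity T q T))
    (hP : ∀ t ∈ Set.Icc 0 T, HasDerivWithinAt P
      (-(ContinuousLinearMap.adjoint (fderiv ℝ f (q t)) (u t))) (Set.Icc 0 T) t) :
    (∀ t ∈ Set.Icc 0 T, velocity T u t + P t = 0) ∧
      u T + gradVel φ (q T) (velocity T q T) = 0 := by
  have hu := h.admissible.contDiff_control
  have huc : ContinuousOn u (Set.Icc 0 T) := hu.continuousOn
  have hqc : ContinuousOn q (Set.Icc 0 T) := h.admissible.contDiff_state.continuousOn
  have hPc : ContinuousOn P (Set.Icc 0 T) := fun t ht => (hP t ht).continuousWithinAt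
  have huP : ContinuousOn (fun t => velocity T u t + P t) (Set.Icc 0 T) :=
    (hu.velocity (m := 0) hT (by norm_num)).continuousOn.add hPc
  refine eq_zero_of_integral_inner_eq_inner_end hT huP fun w hw hw0 => ?_
  set η : ℝ → Config n := fun t => ∫ s in (0 : ℝ)..t, w s with hη_def
  have hηd : ∀ t, HasDerivAt η (w t) t := fun t =>
    intervalIntegral.integral_hasDerivAt_right (hw.continuous.intervalIntegrable _ _)
      (hw.continuous.stronglyMeasurableAtFilter _ _) hw.continuous.continuousAt
  have hη' : deriv η = w := funext fun t => (hηd t).deriv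
  have hη0 : η 0 = 0 := by simp [hη_def]
  have hη : ContDiff ℝ 3 η := by
    have : ContDiff ℝ (2 + 1) η := contDiff_succ_iff_deriv.2
      ⟨fun t => (hηd t).differentiableAt, by simp, by rwa [hη']⟩
    exact this.of_le (by norm_num)
  have hvar := h.first_variation_eq_zero hT hN hf hφ hη hη0 (by rw [hη', hw0])
  rw [hη', ← inner_gradPos_add_inner_gradVel (hφ.differentiable one_ne_zero)] at hvar
  have hwc : Continuous w := hw.continuous
  have hηc : Continuous η := hη.continuous
  have hw'c : Continuous (deriv w) := hw.continuous_deriv (by norm_num)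
  have hi1 : IntervalIntegrable (fun t => inner ℝ (u t) (deriv w t - fderiv ℝ f (q t) (η t)))
      MeasureTheory.volume 0 T := by
    refine ContinuousOn.intervalIntegrable_of_Icc hT.le
      (huc.inner (hw'c.continuousOn.sub ?_))
    exact ((hf.continuous_fderiv one_ne_zero).comp_continuousOn hqc).clm_apply hηc.continuousOn
  have hi2 : IntervalIntegrable (fun t => inner ℝ (velocity T u t + P t) (w t))
      MeasureTheory.volume 0 T :=
    (huP.inner hwc.continuousOn).intervalIntegrable_of_Icc hT.le
  -- Integration by parts: the integrand is the derivative of `⟨u, w⟩ + ⟨P, η⟩`.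
  have hftc := intervalIntegral.integral_eq_sub_of_hasDerivAt_of_le
    (f := fun t => inner ℝ (u t) (w t) + inner ℝ (P t) (η t))
    (f' := fun t => inner ℝ (u t) (deriv w t - fderiv ℝ f (q t) (η t)) +
      inner ℝ (velocity T u t + P t) (w t)) hT.le
    ((huc.inner hwc.continuousOn).add (hPc.inner hηc.continuousOn))
    (fun t ht => by
      have htS := Set.Ioo_subset_Icc_self ht
      have hnhds : Set.Icc 0 T ∈ nhds t := Icc_mem_nhds ht.1 ht.2
      have h1 := ((hu.hasDerivWithinAt_velocity one_ne_zero htS).hasDerivAt hnhds).inner ℝ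
        ((hw.differentiable (by norm_num) t).hasDerivAt)
      have h2 := ((hP t htS).hasDerivAt hnhds).inner ℝ (hηd t)
      convert! h1.add h2 using 1
      rw [inner_neg_left, ContinuousLinearMap.adjoint_inner_left, inner_sub_right, inner_add_left]
      ring) (hi1.add hi2)
  rw [intervalIntegral.integral_add hi1 hi2] at hftc
  simp only [hw0, hη0, hPT, inner_zero_right, inner_neg_left, add_zero, sub_zero] at hftc
  rw [inner_add_left]
  linarith

/-- The primitive of `-Df(q)ᵀ u` with end value `-∂φ/∂q` and the control `u` itself form a lift with
multiplier `-1`. -/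
theorem IsOptimal.exists_isPontryaginLift (hT : 0 < T) (hN : IsOpen N) (hf : ContDiff ℝ 1 f)
    (hφ : ContDiff ℝ 1 φ) (h : IsOptimal T N f φ q₀ v₀ q u) :
    ∃ lq lv : ℝ → Config n, IsPontryaginLift T f φ q u lq lv (-1) := by
  have hu := h.admissible.contDiff_control
  have hq := h.admissible.contDiff_state
  have hA := (continuousOn_adjoint_fderiv_apply hf hq.continuousOn hu.continuousOn).neg
  obtain ⟨P, hPT, hP⟩ := exists_hasDerivWithinAt_Icc hA (-gradPos φ (q T) (velocity T q T))
  obtain ⟨hEL, hend⟩ := h.euler_lagrange hT hN hf hφ hPT hP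
  have hnhds : ∀ t ∈ Set.Ioo 0 T, Set.Icc 0 T ∈ nhds t := fun t ht => Icc_mem_nhds ht.1 ht.2
  refine ⟨P, u, by norm_num, Or.inl (by norm_num),
    exists_lipschitzOnWith_Icc_of_hasDerivWithinAt hA hP,
    hu.exists_lipschitzOnWith one_ne_zero (convex_Icc 0 T) isCompact_Icc,
    ?_, ?_, ?_, ?_, ?_, ?_, ?_⟩
  · refine ae_restrict_Icc_of_forall_mem_Ioo fun t ht => ?_
    rw [gradient_controlHamiltonian_adjoint_pos]
    exact (hq.hasDerivWithinAt_velocity (by norm_num) (Set.Ioo_subset_Icc_self ht)).hasDerivAt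
      (hnhds t ht)
  · refine ae_restrict_Icc_of_forall_mem_Ioo fun t ht => ?_
    have htS := Set.Ioo_subset_Icc_self ht
    rw [gradient_controlHamiltonian_adjoint_vel, ← h.admissible.dynamics t htS]
    exact ((hq.velocity (m := 2) hT (by norm_num)).hasDerivWithinAt_velocity
      (by norm_num) htS).hasDerivAt (hnhds t ht)
  · refine ae_restrict_Icc_of_forall_mem_Ioo fun t ht => ?_
    rw [gradient_controlHamiltonian_pos _ _ _ _ _ _ (hf.differentiable one_ne_zero _)]
    exact (hP t (Set.Ioo_subset_Icc_self ht)).hasDerivAt (hnhds t ht)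
  · refine ae_restrict_Icc_of_forall_mem_Ioo fun t ht => ?_
    have htS := Set.Ioo_subset_Icc_self ht
    rw [gradient_controlHamiltonian_vel, ← eq_neg_of_add_eq_zero_left (hEL t htS)]
    exact (hu.hasDerivWithinAt_velocity one_ne_zero htS).hasDerivAt (hnhds t ht)
  · refine ae_restrict_Icc_of_forall_mem_Ioo fun t _ => ?_
    rw [gradient_controlHamiltonian_control]
    simp
  · simp [hPT]
  · simp [eq_neg_of_add_eq_zero_left hend]

end Existence

theorem theorem1 {n : ℕ} {T : ℝ} (hT : 0 < T) {N : Set (Config n)} (hN : IsOpen N)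
    {f : Config n → Config n} (hf : ContDiff ℝ 1 f)
    {φ : Config n × Config n → ℝ} (hφ : ContDiff ℝ 1 φ)
    (q₀ v₀ : Config n) (q u : ℝ → Config n) (hopt : IsOptimal T N f φ q₀ v₀ q u) :
    -- adjoints with multiplier `-1` exist, and there are no abnormal ones
    (∃ lq lv : ℝ → Config n, IsPontryaginLift T f φ q u lq lv (-1)) ∧
    (∀ (l₀ : ℝ) (lq lv : ℝ → Config n), IsPontryaginLift T f φ q u lq lv l₀ → l₀ < 0) ∧
    -- all adjoints with multiplier `-1` satisfy the equations, at every time in `[0, T]`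
    (∀ lq lv : ℝ → Config n, IsPontryaginLift T f φ q u lq lv (-1) →
      (∀ t ∈ Set.Icc 0 T,
        HasDerivWithinAt lq (-(ContinuousLinearMap.adjoint (fderiv ℝ f (q t)) (lv t)))
          (Set.Icc 0 T) t ∧
        HasDerivWithinAt lv (-(lq t)) (Set.Icc 0 T) t ∧
        0 = u t - lv t) ∧
      lq T = -gradPos φ (q T) (velocity T q T) ∧
      lv T = -gradVel φ (q T) (velocity T q T)) := by
  have hu := hopt.admissible.contDiff_control.continuousOn
  refine ⟨hopt.exists_isPontryaginLift hT hN hf hφ, fun l₀ lq lv h => h.multiplier_neg hT hu,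
    fun lq lv h => ⟨fun t ht => ⟨h.hasDerivWithinAt_adjoint_pos hf
      hopt.admissible.contDiff_state.continuousOn t ht, h.hasDerivWithinAt_adjoint_vel t ht, ?_⟩,
      ?_, ?_⟩⟩
  · simp [h.adjoint_eq hT hu t ht]
  · simpa using h.transversality_q
  · simpa using h.transversality_v
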